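/- Let $d\in\mathbb{N}$, let $\mathcal{P}_2(\mathbb{R}^d)$ be the set of Borel probability measures on $\mathbb{R}^d$ with finite second moment, and let $f:\mathcal{P}_2(\mathbb{R}^d)\to\mathbb{R}$ and $\mu\in\mathcal{P}_2(\mathbb{R}^d)$. For a probability space $(\Omega,\mathcal{A},\mathbb{P})$ the lift of $f$ is the function $F_\Omega:L^2(\Omega,\mathbb{P};\mathbb{R}^d)\to\mathbb{R}$, $F_\Omega(X)=f(\mathcal{L}(X))$, where $\mathcal{L}(X)$ is the law of $X$; $f$ is called $L_\Omega$-differentiable at $\mu$ if there exists $X\in L^2(\Omega,\mathbb{P};\mathbb{R}^d)$ with $\mathcal{L}(X)=\mu$ such that $F_\Omega$ is Fréchet differentiable at $X$. When $F_\Omega$ is Fréchet differentiable at $X$, $DF_\Omega(X)$ denotes the element of $L^2(\Omega,\mathbb{P};\mathbb{R}^d)$ such that the differential of $F_\Omega$ at $X$ is $Y\mapsto\mathbb{E}[DF_\Omega(X)\cdot Y]$. Let $(\Omega,\mathcal{A},\mathbb{P})$ and $(\tilde\Omega,\tilde{\mathcal{A}},\tilde{\mathbb{P}})$ be two atomless probability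 spaces, i.e. every event of positive probability contains an event of strictly smaller positive probability. Then $f$ is $L_\Omega$-differentiable at $\mu$ if and only if it is $L_{\tilde\Omega}$-differentiable at $\mu$. Moreover, in this case, there is a single function $g\in L^2(\mathbb{R}^d,\mu;\mathbb{R}^d)$ such that, for every $X\in L^2(\Omega,\mathbb{P};\mathbb{R}^d)$ with law $\mu$, $F_\Omega$ is Fréchet differentiable at $X$ with $DF_\Omega(X)=g(X)$ $\mathbb{P}$-almost surely, and, for every $\tilde X\in L^2(\tilde\Omega,\tilde{\mathbb{P}};\mathbb{R}^d)$ with law $\mu$, $F_{\tilde\Omega}$ is Fréchet differentiable at $\tilde X$ with $DF_{\tilde\Omega}(\tilde X)=g(\tilde X)$ $\tilde{\mathbb{P}}$-almost surely. -/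

import Mathlib

open MeasureTheory
open scoped ENNReal

noncomputable section

/-- A finite measure `P` is atomless: every measurable set of positive measure has a measurable
subset whose measure is positive and strictly smaller. This concerns all measurable sets,
not just singletons. -/
def IsAtomless {Ω : Type*} [MeasurableSpace Ω] (P : Measure Ω) : Prop :=
  ∀ A : Set Ω, MeasurableSet A → 0 < P A →
    ∃ B : Set Ω, B ⊆ A ∧ MeasurableSet B ∧ 0 < P B ∧ P B < P A

/-- `𝒫₂(ℝᵈ)`: Borel probability measures on `ℝᵈ` with finite second moment. -/
def P2 (d : ℕ) : Type :=
  {μ : Measure (EuclideanSpace ℝ (Fin d)) //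
    IsProbabilityMeasure μ ∧ ∫⁻ x, ‖x‖ₑ ^ 2 ∂μ < ∞}

/-- `L²(Ω, P; ℝᵈ)`, a Hilbert space of almost sure equivalence classes. -/
abbrev L2 {Ω : Type*} [MeasurableSpace Ω] (P : Measure Ω) (d : ℕ) : Type _ :=
  Lp (EuclideanSpace ℝ (Fin d)) 2 P

section Lift

variable {Ω : Type*} [MeasurableSpace Ω] {d : ℕ}

theorem L2.measurable {P : Measure Ω} (X : L2 P d) : Measurable X :=
  (Lp.stronglyMeasurable X).measurable

theorem L2.lintegral_sq_map_lt_top {P : Measure Ω} (X : L2 P d) :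
    ∫⁻ x, ‖x‖ₑ ^ 2 ∂(P.map X) < ∞ := by
  rw [lintegral_map (by fun_prop) X.measurable]
  have h := (Lp.memLp X).2
  rw [eLpNorm_lt_top_iff_lintegral_rpow_enorm_lt_top (by norm_num) (by norm_num)] at h
  simpa using h

/-- The law of `X ∈ L²(Ω, P; ℝᵈ)`, as an element of `𝒫₂(ℝᵈ)`. -/
def law (P : Measure Ω) [IsProbabilityMeasure P] (X : L2 P d) : P2 d :=
  ⟨P.map X, Measure.isProbabilityMeasure_map X.measurable.aemeasurable,
    X.lintegral_sq_map_lt_top⟩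

theorem measurePreserving_of_law_eq {P : Measure Ω} [IsProbabilityMeasure P] {X : L2 P d}
    {μ : P2 d} (h : law P X = μ) : MeasurePreserving X P μ.1 :=
  ⟨X.measurable, congrArg Subtype.val h⟩

/-- The lift of `f : 𝒫₂(ℝᵈ) → ℝ` to `L²(Ω, P; ℝᵈ)`. -/
def lift (P : Measure Ω) [IsProbabilityMeasure P] (f : P2 d → ℝ) (X : L2 P d) : ℝ :=
  f (law P X)

/-- `f` is `L_Ω`-differentiable at `μ`: its lift is Fréchet differentiable at some `X ∼ μ`. -/
def LDifferentiableAt (P : Measure Ω) [IsProbabilityMeasure P] (f : P2 d → ℝ) (μ : P2 d) : Prop :=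
  ∃ X : L2 P d, law P X = μ ∧ DifferentiableAt ℝ (lift P f) X

/-- `g ∈ L²(ℝᵈ, μ; ℝᵈ)` represents the Fréchet derivatives of the lift of `f` above `μ`:
at every `X ∼ μ` in `L²(Ω, P; ℝᵈ)` the lift is Fréchet differentiable, with derivative
`Y ↦ E[g(X) · Y]`. -/
def IsLDerivativeAt (P : Measure Ω) [IsProbabilityMeasure P] (f : P2 d → ℝ) (μ : P2 d)
    (g : L2 μ.1 d) : Prop :=
  ∀ (X : L2 P d) (hX : law P X = μ),
    HasGradientAt (lift P f)
      (Lp.compMeasurePreserving X (measurePreserving_of_law_eq hX) g) X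

end Lift

end

/-!
An atomless space carries, for every coupling extending the law of a given variable, a realisation
of that coupling whose marginal is uniformly as close as desired to the given variable. Hence if
`ξ` is the gradient of the lift at `X`, then `ξ'` is the gradient at `X'` for every pair
`(X', ξ')`, on any probability space, with the joint law of `(X, ξ)`: a competitor `Y'` of `X'` is
copied to a competitor of `X`, up to an error that can be sent to `0`.

Apply this to `(X', ξ₁)` and `(X', ξ₂)`, where `ξ₁` and `ξ₂` are copies of `ξ` that are
conditionally independent given `X'`. Both are gradients at `X'`, so they coincide, which forces
`ξ = g(X)` for some function `g`. As the law of `(X, g(X))` depends only on that of `X`, the same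
`g` gives the gradient at every variable with the law of `X`, on any probability space.
-/

open ProbabilityTheory Filter Topology Set

section Atomless

variable {Ω : Type*} [MeasurableSpace Ω] {P : Measure Ω}

theorem IsAtomless.restrict (hP : IsAtomless P) {S : Set Ω} (hS : MeasurableSet S) :
    IsAtomless (P.restrict S) := by
  intro A hA hA0
  rw [Measure.restrict_apply hA] at hA0
  obtain ⟨B, hBA, hB, hB0, hlt⟩ := hP (A ∩ S) (hA.inter hS) hA0
  have hBS : P.restrict S B = P B := Measure.restrict_eq_self P (hBA.trans inter_subset_right)
  refine ⟨B, hBA.trans inter_subset_left, hB, ?_, ?_⟩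
  · rwa [hBS]
  · rwa [hBS, Measure.restrict_apply hA]

theorem IsAtomless.exists_subset_measure_le_half [IsFiniteMeasure P] (hP : IsAtomless P)
    {A : Set Ω} (hA : MeasurableSet A) (hA0 : 0 < P A) :
    ∃ B ⊆ A, MeasurableSet B ∧ 0 < P B ∧ P B ≤ P A / 2 := by
  obtain ⟨B, hBA, hB, hB0, hlt⟩ := hP A hA hA0
  have hadd : P B + P (A \ B) = P A := by
    rw [measure_sdiff hBA hB.nullMeasurableSet (measure_ne_top P B), add_tsub_cancel_of_le hlt.le]
  rcases le_or_gt (P B) (P A / 2) with hle | hgt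
  · exact ⟨B, hBA, hB, hB0, hle⟩
  · refine ⟨A \ B, sdiff_subset, hA.diff hB, ?_, ?_⟩
    · rw [measure_sdiff hBA hB.nullMeasurableSet (measure_ne_top P B)]
      exact tsub_pos_of_lt hlt
    · by_contra! hgt'
      have := ENNReal.add_lt_add hgt hgt'
      rw [ENNReal.add_halves, hadd] at this
      exact this.false

theorem IsAtomless.exists_subset_measure_le [IsFiniteMeasure P] (hP : IsAtomless P)
    {ε : ℝ≥0∞} (hε : 0 < ε) {A : Set Ω} (hA : MeasurableSet A) (hA0 : 0 < P A) :
    ∃ B ⊆ A, MeasurableSet B ∧ 0 < P B ∧ P B ≤ ε := by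
  have iterate_half (n : ℕ) : ∃ B ⊆ A, MeasurableSet B ∧ 0 < P B ∧ P B ≤ P A * 2⁻¹ ^ n := by
    induction n with
    | zero => exact ⟨A, subset_rfl, hA, hA0, by simp⟩
    | succ n ih =>
      obtain ⟨B, hBA, hB, hB0, hBle⟩ := ih
      obtain ⟨C, hCB, hC, hC0, hCle⟩ := hP.exists_subset_measure_le_half hB hB0
      refine ⟨C, hCB.trans hBA, hC, hC0, hCle.trans ?_⟩
      rw [pow_succ, ← mul_assoc, div_eq_mul_inv]
      gcongr
  have hlim : Tendsto (fun n : ℕ ↦ P A * (2⁻¹ : ℝ≥0∞) ^ n) atTop (𝓝 0) := by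
    simpa only [mul_zero] using ENNReal.Tendsto.const_mul (a := P A)
      (ENNReal.tendsto_pow_atTop_nhds_zero_of_lt_one (r := 2⁻¹) (by simp))
      (Or.inr (measure_ne_top P A))
  obtain ⟨n, hn⟩ := (hlim.eventually (ge_mem_nhds hε)).exists
  obtain ⟨B, hBA, hB, hB0, hBle⟩ := iterate_half n
  exact ⟨B, hBA, hB, hB0, hBle.trans hn⟩

theorem exists_countable_forall_measure_sUnion_le {𝒮 : Set (Set Ω)} :
    ∃ C ⊆ 𝒮, C.Countable ∧ ∀ D ⊆ 𝒮, D.Countable → P (⋃₀ D) ≤ P (⋃₀ C) := by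
  obtain ⟨u, -, hu, hmem⟩ := exists_seq_tendsto_sSup
    (S := (fun C ↦ P (⋃₀ C)) '' {C | C ⊆ 𝒮 ∧ C.Countable})
    ⟨_, ∅, ⟨empty_subset 𝒮, countable_empty⟩, rfl⟩ (OrderTop.bddAbove _)
  choose C hC hCu using hmem
  refine ⟨⋃ n, C n, iUnion_subset fun n ↦ (hC n).1, countable_iUnion fun n ↦ (hC n).2,
    fun D hD hDc ↦ ?_⟩
  have hle : P (⋃₀ D) ≤ sSup ((fun C ↦ P (⋃₀ C)) '' {C | C ⊆ 𝒮 ∧ C.Countable}) :=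
    le_sSup ⟨D, ⟨hD, hDc⟩, rfl⟩
  refine hle.trans (le_of_tendsto' hu fun n ↦ ?_)
  rw [← hCu n]
  exact measure_mono (sUnion_subset_sUnion (subset_iUnion C n))

theorem exists_countable_measure_compl_sUnion_eq_zero [IsFiniteMeasure P] {𝒮 : Set (Set Ω)}
    (h𝒮 : ∀ s ∈ 𝒮, MeasurableSet s)
    (hP : ∀ A, MeasurableSet A → 0 < P A → ∃ B ∈ 𝒮, B ⊆ A ∧ 0 < P B) :
    ∃ C ⊆ 𝒮, C.Countable ∧ P (⋃₀ C)ᶜ = 0 := by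
  obtain ⟨C, hC, hCc, hmax⟩ := exists_countable_forall_measure_sUnion_le (P := P) (𝒮 := 𝒮)
  have hCm : MeasurableSet (⋃₀ C) := .sUnion hCc fun s hs ↦ h𝒮 s (hC hs)
  refine ⟨C, hC, hCc, ?_⟩
  by_contra h0
  obtain ⟨B, hB, hBC, hB0⟩ := hP _ hCm.compl (pos_iff_ne_zero.2 h0)
  have hle := hmax (insert B C) (insert_subset hB hC) (hCc.insert B)
  rw [sUnion_insert, measure_union (disjoint_compl_left.mono_left hBC) hCm] at hle
  exact (ENNReal.lt_add_right (measure_ne_top P _) hB0.ne').not_ge (add_comm (P B) _ ▸ hle)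

theorem IsAtomless.exists_measurable_nat_measure_preimage_le [IsFiniteMeasure P]
    (hP : IsAtomless P) {ε : ℝ≥0∞} (hε : 0 < ε) :
    ∃ q : Ω → ℕ, Measurable q ∧ ∀ k, P (q ⁻¹' {k}) ≤ ε := by
  classical
  obtain ⟨C, hC, hCc, hC0⟩ := exists_countable_measure_compl_sUnion_eq_zero (P := P)
    (𝒮 := {s | MeasurableSet s ∧ P s ≤ ε}) (fun s hs ↦ hs.1) fun A hA hA0 ↦
      let ⟨B, hBA, hB, hB0, hBε⟩ := hP.exists_subset_measure_le hε hA hA0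
      ⟨B, ⟨hB, hBε⟩, hBA, hB0⟩
  have hCcompl : MeasurableSet (⋃₀ C)ᶜ := (MeasurableSet.sUnion hCc fun s hs ↦ (hC hs).1).compl
  obtain ⟨S, hS⟩ := (hCc.insert (⋃₀ C)ᶜ).exists_eq_range (insert_nonempty _ _)
  have hSε (n) : MeasurableSet (S n) ∧ P (S n) ≤ ε :=
    insert_subset (t := {s | MeasurableSet s ∧ P s ≤ ε}) ⟨hCcompl, hC0.trans_le zero_le⟩ hC
      (hS ▸ mem_range_self n)
  have hcov (ω) : ∃ n, ω ∈ S n := by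
    have : ω ∈ ⋃₀ range S := by
      rw [← hS, sUnion_insert]
      exact (em (ω ∈ ⋃₀ C)).symm
    simpa using this
  refine ⟨fun ω ↦ Nat.find (hcov ω), measurable_find hcov fun n ↦ (hSε n).1, fun k ↦ ?_⟩
  refine (measure_mono ?_).trans (hSε k).2
  rintro ω rfl
  exact Nat.find_spec (hcov ω)

theorem IsAtomless.exists_measurable_real_nullSingletonClass_map [IsFiniteMeasure P]
    (hP : IsAtomless P) : ∃ U : Ω → ℝ, Measurable U ∧ NullSingletonClass (P.map U) := by
  choose q hq hqε using fun n : ℕ ↦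
    hP.exists_measurable_nat_measure_preimage_le (ε := (n : ℝ≥0∞)⁻¹) (by simp)
  have he := measurableEmbedding_embeddingReal (ℕ → ℕ)
  have hU := he.measurable.comp (measurable_pi_lambda (fun ω n ↦ q n ω) hq)
  refine ⟨_, hU, ⟨fun u ↦ ?_⟩⟩
  -- A point determines a sequence `a`, and its preimage lies in `q n ⁻¹' {a n}` for every `n`.
  rw [Measure.map_apply hU (measurableSet_singleton u), preimage_comp]
  rcases (subsingleton_singleton.preimage he.injective).eq_empty_or_singleton with h | ⟨a, h⟩
  · rw [h, preimage_empty, measure_empty]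
  · rw [h]
    refine le_antisymm (ge_of_tendsto' ENNReal.tendsto_inv_nat_nhds_zero fun n ↦ ?_) zero_le
    exact (measure_mono fun ω hω ↦ congrFun hω n).trans (hqε n (a n))

end Atomless

section Realisation

theorem continuous_cdf (μ : Measure ℝ) [IsProbabilityMeasure μ] [NullSingletonClass μ] :
    Continuous (cdf μ) := by
  refine continuous_iff_continuousAt.2 fun x ↦ ?_
  rw [(cdf μ).mono.continuousAt_iff_leftLim_eq_rightLim, (cdf μ).rightLim_eq]
  have hjump := (cdf μ).measure_singleton x
  rw [measure_cdf, measure_singleton, eq_comm, ENNReal.ofReal_eq_zero, sub_nonpos] at hjump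
  exact le_antisymm ((cdf μ).mono.leftLim_le le_rfl) hjump

theorem exists_cdf_eq (μ : Measure ℝ) [IsProbabilityMeasure μ] [NullSingletonClass μ] {t : ℝ}
    (ht : t ∈ Ioo 0 1) : ∃ x, cdf μ x = t := by
  obtain ⟨a, ha⟩ := ((tendsto_cdf_atBot μ).eventually (ge_mem_nhds ht.1)).exists
  obtain ⟨b, hb⟩ := ((tendsto_cdf_atTop μ).eventually (le_mem_nhds ht.2)).exists
  exact mem_range_of_exists_le_of_exists_ge (continuous_cdf μ) ⟨a, ha⟩ ⟨b, hb⟩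

theorem measureReal_cdf_le (μ : Measure ℝ) [IsProbabilityMeasure μ] [NullSingletonClass μ] {t : ℝ}
    (ht : t ∈ Icc 0 1) : μ.real {x | cdf μ x ≤ t} = t := by
  refine le_antisymm (le_of_forall_gt_imp_ge_of_dense fun s hts ↦ ?_)
    (le_of_forall_lt_imp_le_of_dense fun s hst ↦ ?_)
  · rcases le_or_gt 1 s with hs | hs
    · exact measureReal_le_one.trans hs
    obtain ⟨y, rfl⟩ := exists_cdf_eq μ ⟨ht.1.trans_lt hts, hs⟩
    rw [cdf_eq_real]
    exact measureReal_mono fun x hx ↦ ((monotone_cdf μ).reflect_lt (lt_of_le_of_lt hx hts)).le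
  · rcases le_or_gt s 0 with hs | hs
    · exact hs.trans measureReal_nonneg
    obtain ⟨y, rfl⟩ := exists_cdf_eq μ ⟨hs, hst.trans_le ht.2⟩
    rw [cdf_eq_real]
    exact measureReal_mono fun x hx ↦ (monotone_cdf μ hx).trans hst.le

theorem measurePreserving_cdf (μ : Measure ℝ) [IsProbabilityMeasure μ] [NullSingletonClass μ] :
    MeasurePreserving (fun x ↦ (⟨cdf μ x, cdf_nonneg μ x, cdf_le_one μ x⟩ : unitInterval)) μ := by
  have hm : Measurable fun x ↦ (⟨cdf μ x, cdf_nonneg μ x, cdf_le_one μ x⟩ : unitInterval) :=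
    (monotone_cdf μ).measurable.subtype_mk
  have := Measure.isProbabilityMeasure_map (μ := μ) hm.aemeasurable
  refine ⟨hm, Measure.ext_of_Iic _ _ fun t ↦ ?_⟩
  rw [unitInterval.volume_Iic, Measure.map_apply hm measurableSet_Iic, ← ofReal_measureReal]
  exact congrArg ENNReal.ofReal (measureReal_cdf_le μ t.2)

theorem ext_of_singleton_prod {ι E : Type*} [Countable ι] [MeasurableSpace ι]
    [MeasurableSingletonClass ι] [MeasurableSpace E] {ρ σ : Measure (ι × E)}
    (h : ∀ i s, MeasurableSet s → ρ ({i} ×ˢ s) = σ ({i} ×ˢ s)) : ρ = σ := by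
  ext A hA
  have hslice (i : ι) : MeasurableSet (Prod.mk i ⁻¹' A) := measurable_prodMk_left hA
  have hunion : A = ⋃ i, {i} ×ˢ (Prod.mk i ⁻¹' A) := by ext ⟨i, y⟩; simp
  have hdisj : Pairwise (Function.onFun Disjoint fun i ↦ ({i} : Set ι) ×ˢ (Prod.mk i ⁻¹' A)) :=
    fun i j hij ↦ (disjoint_singleton.2 hij).set_prod_left _ _
  have hmeas (i : ι) := (measurableSet_singleton i).prod (hslice i)
  rw [hunion, measure_iUnion hdisj hmeas, measure_iUnion hdisj hmeas]
  exact tsum_congr fun i ↦ h i _ (hslice i)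

variable {E : Type*} [MeasurableSpace E] [StandardBorelSpace E] [Nonempty E]

theorem exists_measurePreserving_of_nullSingletonClass (μ : Measure ℝ) [IsProbabilityMeasure μ]
    [NullSingletonClass μ] (ν : Measure E) [IsProbabilityMeasure ν] :
    ∃ φ : ℝ → E, MeasurePreserving φ μ ν := by
  obtain ⟨φ, hφ, hφν⟩ := ν.exists_measurable_map_eq
  exact ⟨_, .comp ⟨hφ, hφν⟩ (measurePreserving_cdf μ)⟩

variable {Ω : Type*} [MeasurableSpace Ω] {P : Measure Ω} [IsFiniteMeasure P]

theorem IsAtomless.exists_measurePreserving_smul (hP : IsAtomless P) (ν : Measure E)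
    [IsProbabilityMeasure ν] : ∃ Y : Ω → E, MeasurePreserving Y P (P univ • ν) := by
  rcases eq_or_ne P 0 with rfl | hP0
  · exact ⟨fun _ ↦ Classical.arbitrary E, measurable_const, by simp⟩
  obtain ⟨U, hU, _⟩ := hP.exists_measurable_real_nullSingletonClass_map
  have hUuniv : P.map U univ = P univ := by rw [Measure.map_apply hU .univ, preimage_univ]
  have hUprob : IsProbabilityMeasure ((P univ)⁻¹ • P.map U) := ⟨by
    rw [Measure.smul_apply, hUuniv, smul_eq_mul, ENNReal.inv_mul_cancel
      (Measure.measure_univ_ne_zero.2 hP0) (measure_ne_top P univ)]⟩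
  have : NullSingletonClass ((P univ)⁻¹ • P.map U) := ⟨fun x ↦ by simp⟩
  obtain ⟨φ, hφ⟩ := exists_measurePreserving_of_nullSingletonClass ((P univ)⁻¹ • P.map U) ν
  refine ⟨φ ∘ U, hφ.measurable.comp hU, ?_⟩
  rw [← Measure.map_map hφ.measurable hU, ← hφ.map_eq, Measure.map_smul, smul_smul,
    ENNReal.mul_inv_cancel (Measure.measure_univ_ne_zero.2 hP0) (measure_ne_top P univ), one_smul]

variable {ι : Type*} [Countable ι] [MeasurableSpace ι] [MeasurableSingletonClass ι]

theorem IsAtomless.exists_measurePreserving_prodMk (hP : IsAtomless P) {N : Ω → ι}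
    (hN : Measurable N) {ρ : Measure (ι × E)} (hρ : ρ.fst = P.map N) :
    ∃ Y : Ω → E, MeasurePreserving (fun ω ↦ (N ω, Y ω)) P ρ := by
  have : IsFiniteMeasure ρ := ⟨by rw [← Measure.fst_univ, hρ]; exact measure_lt_top _ _⟩
  have hcell (i : ι) : MeasurableSet (N ⁻¹' {i}) := hN (measurableSet_singleton i)
  choose Y hY using fun i ↦ (hP.restrict (hcell i)).exists_measurePreserving_smul (ρ.condKernel i)
  have hYm : Measurable fun p : ι × Ω ↦ Y p.1 p.2 :=
    measurable_from_prod_countable_right fun i ↦ (hY i).measurable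
  have hglue : Measurable fun ω ↦ (N ω, Y (N ω) ω) :=
    hN.prodMk (hYm.comp (hN.prodMk measurable_id))
  refine ⟨fun ω ↦ Y (N ω) ω, hglue, ext_of_singleton_prod fun i s hs ↦ ?_⟩
  calc P.map (fun ω ↦ (N ω, Y (N ω) ω)) ({i} ×ˢ s)
      = P (Y i ⁻¹' s ∩ N ⁻¹' {i}) := by
        rw [Measure.map_apply hglue ((measurableSet_singleton i).prod hs)]
        congr 1
        ext ω
        simp only [mem_preimage, mem_prod, mem_singleton_iff, mem_inter_iff,
          and_comm (b := N ω = i)]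
        exact and_congr_right fun h ↦ by rw [h]
    _ = P (N ⁻¹' {i}) * ρ.condKernel i s := by
        rw [← Measure.restrict_apply ((hY i).measurable hs),
          (hY i).measure_preimage hs.nullMeasurableSet, Measure.smul_apply,
          Measure.restrict_apply_univ, smul_eq_mul]
    _ = ρ ({i} ×ˢ s) := by
        rw [← Measure.setLIntegral_condKernel_eq_measure_prod (measurableSet_singleton i) hs,
          lintegral_singleton, hρ, Measure.map_apply hN (measurableSet_singleton i), mul_comm]

end Realisation

section Coupling

theorem exists_measurable_nat_forall_eq_imp_dist_lt (W : Type*) [PseudoMetricSpace W]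
    [TopologicalSpace.SeparableSpace W] [Nonempty W] [MeasurableSpace W] [OpensMeasurableSpace W]
    {η : ℝ} (hη : 0 < η) :
    ∃ r : W → ℕ, Measurable r ∧ ∀ w w', r w = r w' → dist w w' < η := by
  classical
  have hdense (w : W) : ∃ n, dist w (TopologicalSpace.denseSeq W n) < η / 2 :=
    (TopologicalSpace.denseRange_denseSeq W).exists_dist_lt w (half_pos hη)
  refine ⟨fun w ↦ Nat.find (hdense w), measurable_find hdense fun n ↦
    measurableSet_lt (by fun_prop) measurable_const, fun w w' hww' ↦ ?_⟩
  have hw := Nat.find_spec (hdense w)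
  have hw' := Nat.find_spec (hdense w')
  rw [← show Nat.find (hdense w) = Nat.find (hdense w') from hww'] at hw'
  linarith [dist_triangle_right w w' (TopologicalSpace.denseSeq W (Nat.find (hdense w)))]

theorem IsAtomless.exists_measurePreserving_ae_dist_lt {Ω : Type*} [MeasurableSpace Ω]
    {P : Measure Ω} [IsFiniteMeasure P] (hP : IsAtomless P)
    {W : Type*} [PseudoMetricSpace W] [TopologicalSpace.SeparableSpace W] [MeasurableSpace W]
    [OpensMeasurableSpace W] {V : Type*} [MeasurableSpace V] [StandardBorelSpace V] [Nonempty V]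
    {Z : Ω → W} (hZ : Measurable Z) {ρ : Measure V} {π : V → W} (hπ : Measurable π)
    (hρ : ρ.map π = P.map Z) {η : ℝ} (hη : 0 < η) :
    ∃ T : Ω → V, MeasurePreserving T P ρ ∧ ∀ᵐ ω ∂P, dist (π (T ω)) (Z ω) < η := by
  have : Nonempty W := ‹Nonempty V›.map π
  -- `π ∘ T = Z` may have no solution (`Z` may generate the whole σ-algebra), so `T` only has to
  -- match `Z` through the index `r` of a countable partition into small cells.
  obtain ⟨r, hr, hrη⟩ := exists_measurable_nat_forall_eq_imp_dist_lt W hη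
  have hgraph : Measurable fun v ↦ (r (π v), v) := (hr.comp hπ).prodMk measurable_id
  have hfst : (ρ.map fun v ↦ (r (π v), v)).fst = P.map (r ∘ Z) := by
    rw [Measure.fst_map_prodMk measurable_id', ← Measure.map_map hr hZ, ← hρ, Measure.map_map hr hπ]
    rfl
  obtain ⟨T, hT⟩ := hP.exists_measurePreserving_prodMk (hr.comp hZ) hfst
  refine ⟨T, ⟨measurable_snd.comp hT.measurable, ?_⟩, ?_⟩
  · have hsnd := congrArg Measure.snd hT.map_eq
    rwa [Measure.snd_map_prodMk (hr.comp hZ),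
      Measure.snd_map_prodMk (X := fun v ↦ r (π v)) (hr.comp hπ), Measure.map_id'] at hsnd
  · have hcell : ∀ᵐ p ∂ρ.map fun v ↦ (r (π v), v), r (π p.2) = p.1 :=
      (ae_map_iff hgraph.aemeasurable (measurableSet_eq_fun (by fun_prop) (by fun_prop))).2
        (Eventually.of_forall fun _ ↦ rfl)
    filter_upwards [hT.quasiMeasurePreserving.ae hcell] with ω hω
    exact hrη _ _ hω

end Coupling

section Lp

variable {Ω : Type*} [MeasurableSpace Ω] {P : Measure Ω}
  {Ω' : Type*} [MeasurableSpace Ω'] {P' : Measure Ω'} {p : ℝ≥0∞}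
  {E : Type*} [NormedAddCommGroup E]

theorem norm_sub_le_of_ae_dist_le [IsProbabilityMeasure P]
    {X Y : Lp E p P} {C : ℝ} (hC : 0 ≤ C) (h : ∀ᵐ ω ∂P, dist (X ω) (Y ω) ≤ C) :
    ‖X - Y‖ ≤ C := by
  have hbound := Lp.norm_le_of_ae_bound (f := X - Y) hC (by
    filter_upwards [h, Lp.coeFn_sub X Y] with ω hω hsub
    rwa [hsub, Pi.sub_apply, ← dist_eq_norm])
  simpa [measureUnivNNReal] using hbound

theorem exists_compMeasurePreserving_eq {α : Type*} [MeasurableSpace α]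
    {μ : Measure α} {X : Ω → α} (hX : MeasurePreserving X P μ) {ξ : Lp E p P} {g : α → E}
    (hg : AEStronglyMeasurable g μ) (hξ : ξ =ᵐ[P] g ∘ X) :
    ∃ g' : Lp E p μ, Lp.compMeasurePreserving X hX g' = ξ := by
  have hgp : MemLp g p μ := by
    rw [← hX.map_eq] at hg ⊢
    exact (memLp_map_measure_iff hg hX.measurable.aemeasurable).2 ((Lp.memLp ξ).ae_eq hξ)
  refine ⟨hgp.toLp, ?_⟩
  rw [Lp.toLp_compMeasurePreserving]
  exact Lp.ext ((MemLp.coeFn_toLp _).trans hξ.symm)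

variable [MeasurableSpace E] [BorelSpace E]

theorem identDistrib_prodMk_compMeasurePreserving {α : Type*} [MeasurableSpace α] {μ : Measure α}
    {X : Ω → α} (hX : MeasurePreserving X P μ) (g : Lp E p μ) :
    IdentDistrib (fun x ↦ (x, g x)) (fun ω ↦ (X ω, Lp.compMeasurePreserving X hX g ω)) μ P := by
  have hg : Measurable fun x ↦ (x, g x) :=
    measurable_id.prodMk (Lp.stronglyMeasurable g).measurable
  have hmap := Measure.map_map (μ := P) hg hX.measurable
  rw [hX.map_eq] at hmap
  have hgX : IdentDistrib (fun x ↦ (x, g x)) (fun ω ↦ (X ω, g (X ω))) μ P :=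
    ⟨hg.aemeasurable, (hg.comp hX.measurable).aemeasurable, hmap⟩
  refine hgX.trans (.of_ae_eq hgX.aemeasurable_snd ?_)
  filter_upwards [Lp.coeFn_compMeasurePreserving g hX] with ω hω
  rw [hω, Function.comp_apply]

variable [SecondCountableTopology E]

theorem norm_sub_eq_of_identDistrib {X Y : Lp E p P} {X' Y' : Lp E p P'}
    (h : IdentDistrib (fun ω ↦ (X ω, Y ω)) (fun ω ↦ (X' ω, Y' ω)) P P') :
    ‖X - Y‖ = ‖X' - Y'‖ := by
  have hsub : IdentDistrib (⇑X - ⇑Y) (⇑X' - ⇑Y') P P' :=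
    h.comp (measurable_fst.sub measurable_snd)
  rw [Lp.norm_def, Lp.norm_def, eLpNorm_congr_ae (Lp.coeFn_sub X Y),
    eLpNorm_congr_ae (Lp.coeFn_sub X' Y'), hsub.eLpNorm_eq]

theorem inner_eq_of_identDistrib [InnerProductSpace ℝ E] {X Y : Lp E 2 P} {X' Y' : Lp E 2 P'}
    (h : IdentDistrib (fun ω ↦ (X ω, Y ω)) (fun ω ↦ (X' ω, Y' ω)) P P') :
    inner ℝ X Y = inner ℝ X' Y' := by
  have hinner : IdentDistrib (fun ω ↦ inner ℝ (X ω) (Y ω)) (fun ω ↦ inner ℝ (X' ω) (Y' ω)) P P' :=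
    h.comp (measurable_fst.inner measurable_snd)
  rw [L2.inner_def, L2.inner_def, hinner.integral_eq]

theorem IsAtomless.exists_identDistrib_norm_sub_le [CompleteSpace E] [IsProbabilityMeasure P]
    (hP : IsAtomless P) {X ξ : Lp E p P} {X' ξ' : Lp E p P'}
    (h : IdentDistrib (fun ω ↦ (X ω, ξ ω)) (fun ω ↦ (X' ω, ξ' ω)) P P') (Y' : Lp E p P')
    {η : ℝ} (hη : 0 < η) :
    ∃ A B Y : Lp E p P,
      IdentDistrib (fun ω ↦ (A ω, B ω, Y ω)) (fun ω ↦ (X' ω, ξ' ω, Y' ω)) P P' ∧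
        ‖A - X‖ ≤ η ∧ ‖B - ξ‖ ≤ η := by
  have hXξ : Measurable fun ω ↦ (X ω, ξ ω) :=
    (Lp.stronglyMeasurable X).measurable.prodMk (Lp.stronglyMeasurable ξ).measurable
  have hXξY' : Measurable fun ω ↦ (X' ω, ξ' ω, Y' ω) :=
    (Lp.stronglyMeasurable X').measurable.prodMk
      ((Lp.stronglyMeasurable ξ').measurable.prodMk (Lp.stronglyMeasurable Y').measurable)
  have hπ : Measurable fun v : E × E × E ↦ (v.1, v.2.1) := by fun_prop
  obtain ⟨T, hT, hTη⟩ := hP.exists_measurePreserving_ae_dist_lt hXξ hπ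
    ((Measure.map_map hπ hXξY').trans h.map_eq.symm) hη
  have hid : IdentDistrib T (fun ω ↦ (X' ω, ξ' ω, Y' ω)) P P' :=
    ⟨hT.measurable.aemeasurable, hXξY'.aemeasurable, hT.map_eq⟩
  have hA : MemLp (fun ω ↦ (T ω).1) p P :=
    (hid.comp measurable_fst).symm.memLp_snd (Lp.memLp X')
  have hB : MemLp (fun ω ↦ (T ω).2.1) p P :=
    (hid.comp (measurable_fst.comp measurable_snd)).symm.memLp_snd (Lp.memLp ξ')
  have hY : MemLp (fun ω ↦ (T ω).2.2) p P :=
    (hid.comp (measurable_snd.comp measurable_snd)).symm.memLp_snd (Lp.memLp Y')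
  refine ⟨hA.toLp, hB.toLp, hY.toLp, ?_, ?_, ?_⟩
  · refine .trans (.symm <| .of_ae_eq hT.measurable.aemeasurable ?_) hid
    filter_upwards [hA.coeFn_toLp, hB.coeFn_toLp, hY.coeFn_toLp] with ω h₁ h₂ h₃
    rw [h₁, h₂, h₃]
  · refine norm_sub_le_of_ae_dist_le hη.le ?_
    filter_upwards [hTη, hA.coeFn_toLp] with ω hω hAω
    rw [hAω]
    exact (le_max_left _ _).trans hω.le
  · refine norm_sub_le_of_ae_dist_le hη.le ?_
    filter_upwards [hTη, hB.coeFn_toLp] with ω hω hBω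
    rw [hBω]
    exact (le_max_right _ _).trans hω.le

theorem IsAtomless.exists_lp_measurePreserving [CompleteSpace E] [IsProbabilityMeasure P]
    (hP : IsAtomless P) {μ : Measure E} [IsProbabilityMeasure μ] (hμ : MemLp id p μ) :
    ∃ X : Lp E p P, MeasurePreserving X P μ := by
  obtain ⟨Y, hY⟩ := hP.exists_measurePreserving_smul μ
  rw [measure_univ, one_smul] at hY
  have hYp : MemLp Y p P := hμ.comp_measurePreserving hY
  exact ⟨hYp.toLp, (Lp.stronglyMeasurable _).measurable,
    (Measure.map_congr hYp.coeFn_toLp).trans hY.map_eq⟩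

end Lp

section CondIndepSquare

variable {α E : Type*} [MeasurableSpace α] [MeasurableSpace E] [StandardBorelSpace E] [Nonempty E]

/-- The law of `(x, y₁, y₂)` where `y₁` and `y₂` are conditionally independent given `x` and both
`(x, y₁)` and `(x, y₂)` have law `ρ`. -/
noncomputable def condIndepSquare (ρ : Measure (α × E)) [IsFiniteMeasure ρ] : Measure (α × E × E) :=
  ρ.fst ⊗ₘ (ρ.condKernel ×ₖ ρ.condKernel)

instance (ρ : Measure (α × E)) [IsProbabilityMeasure ρ] :
    IsProbabilityMeasure (condIndepSquare ρ) := by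
  unfold condIndepSquare
  infer_instance

variable (ρ : Measure (α × E)) [IsFiniteMeasure ρ]

theorem map_condIndepSquare_fst : (condIndepSquare ρ).map (fun p ↦ (p.1, p.2.1)) = ρ := by
  have hmap := Measure.compProd_map (μ := ρ.fst) (κ := ρ.condKernel ×ₖ ρ.condKernel) measurable_fst
  rw [← Kernel.fst_eq, Kernel.fst_prod, ρ.disintegrate] at hmap
  exact hmap.symm

theorem map_condIndepSquare_snd : (condIndepSquare ρ).map (fun p ↦ (p.1, p.2.2)) = ρ := by
  have hmap := Measure.compProd_map (μ := ρ.fst) (κ := ρ.condKernel ×ₖ ρ.condKernel) measurable_snd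
  rw [← Kernel.snd_eq, Kernel.snd_prod, ρ.disintegrate] at hmap
  exact hmap.symm

end CondIndepSquare

theorem exists_stronglyMeasurable_ae_snd_eq {α E : Type*} [MeasurableSpace α]
    [NormedAddCommGroup E] [NormedSpace ℝ E] [CompleteSpace E] [MeasurableSpace E] [BorelSpace E]
    [SecondCountableTopology E] {ρ : Measure (α × E)} [IsFiniteMeasure ρ]
    (h : ∀ᵐ p ∂condIndepSquare ρ, p.2.1 = p.2.2) :
    ∃ g : α → E, StronglyMeasurable g ∧ ∀ᵐ p ∂ρ, p.2 = g p.1 := by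
  have hg : StronglyMeasurable fun x ↦ ∫ y, y ∂ρ.condKernel x :=
    StronglyMeasurable.integral_kernel (f := fun y : E ↦ y) stronglyMeasurable_id
  refine ⟨_, hg, ?_⟩
  suffices ∀ᵐ p ∂(ρ.fst ⊗ₘ ρ.condKernel), p.2 = ∫ y, y ∂ρ.condKernel p.1 by
    rwa [ρ.disintegrate] at this
  refine Measure.ae_compProd_of_ae_ae
    (measurableSet_eq_fun measurable_snd (hg.measurable.comp measurable_fst)) ?_
  filter_upwards [Measure.ae_ae_of_ae_compProd h] with x hx
  rw [Kernel.prod_apply] at hx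
  filter_upwards [Measure.ae_ae_of_ae_prod hx] with y hy
  calc y = ∫ _, y ∂ρ.condKernel x := by simp
    _ = ∫ z, z ∂ρ.condKernel x := integral_congr_ae hy

section LawLift

variable {Ω : Type*} [MeasurableSpace Ω] {P : Measure Ω}
  {Ω' : Type*} [MeasurableSpace Ω'] {P' : Measure Ω'}
  {E : Type*} [NormedAddCommGroup E] [MeasurableSpace E]

/-- The lift of a function `F` of measures on `E` to `L²(Ω, P; E)`. It is defined for every `F` on
`Measure E`, although only its values at laws of square integrable variables matter. -/
noncomputable def lawLift (P : Measure Ω) (F : Measure E → ℝ) (X : Lp E 2 P) : ℝ :=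
  F (P.map X)

variable [InnerProductSpace ℝ E]

/-- The lift of `F` to `L²(Ω, P; E)` is Fréchet differentiable at some `X` with law `μ`; the
analogue of `LDifferentiableAt` for a general Hilbert space `E`. -/
def LawDifferentiableAt (P : Measure Ω) (F : Measure E → ℝ) (μ : Measure E) : Prop :=
  ∃ X : Lp E 2 P, MeasurePreserving X P μ ∧ DifferentiableAt ℝ (lawLift P F) X

variable [CompleteSpace E]

/-- The lift of `F` to `L²(Ω, P; E)` has gradient `g(X)` at every `X` with law `μ`; the analogue of
`IsLDerivativeAt` for a general Hilbert space `E`. -/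
def HasLawGradientAt (P : Measure Ω) (F : Measure E → ℝ) (μ : Measure E) (g : Lp E 2 μ) : Prop :=
  ∀ (X : Lp E 2 P) (hX : MeasurePreserving X P μ),
    HasGradientAt (lawLift P F) (Lp.compMeasurePreserving X hX g) X

theorem abs_sub_inner_sub_le {H : Type*} [NormedAddCommGroup H] [InnerProductSpace ℝ H] (t : ℝ)
    (X ξ A B Y : H) :
    |t - inner ℝ B (Y - A)| ≤
      |t - inner ℝ ξ (Y - X)| + ‖B - ξ‖ * ‖Y - A‖ + ‖ξ‖ * ‖A - X‖ := by
  have hsplit : t - inner ℝ B (Y - A) =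
      t - inner ℝ ξ (Y - X) - inner ℝ (B - ξ) (Y - A) + inner ℝ ξ (A - X) := by
    simp only [inner_sub_left, inner_sub_right]
    ring
  rw [hsplit]
  refine (abs_add_le _ _).trans (add_le_add ((abs_sub _ _).trans (add_le_add le_rfl ?_)) ?_)
  · exact abs_real_inner_le_norm _ _
  · exact abs_real_inner_le_norm _ _

variable [BorelSpace E] [SecondCountableTopology E] [IsProbabilityMeasure P]
  {F : Measure E → ℝ} {μ : Measure E}

theorem IsAtomless.exists_abs_lawLift_sub_inner_le (hP : IsAtomless P) (F : Measure E → ℝ)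
    {X ξ : Lp E 2 P} {X' ξ' : Lp E 2 P'}
    (h : IdentDistrib (fun ω ↦ (X ω, ξ ω)) (fun ω ↦ (X' ω, ξ' ω)) P P') (Y' : Lp E 2 P') {η : ℝ}
    (hη : 0 < η) :
    ∃ Y : Lp E 2 P, ‖Y - X‖ ≤ ‖Y' - X'‖ + η ∧
      |lawLift P' F Y' - lawLift P' F X' - inner ℝ ξ' (Y' - X')| ≤
        |lawLift P F Y - lawLift P F X - inner ℝ ξ (Y - X)| + η * ‖Y' - X'‖ + ‖ξ‖ * η := by
  obtain ⟨A, B, Y, hABY, hAX, hBξ⟩ := hP.exists_identDistrib_norm_sub_le h Y' hη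
  have hYA : ‖Y - A‖ = ‖Y' - X'‖ := norm_sub_eq_of_identDistrib
    (hABY.comp (u := fun v : E × E × E ↦ (v.2.2, v.1)) (by fun_prop))
  have hinner : inner ℝ B (Y - A) = inner ℝ ξ' (Y' - X') := by
    rw [inner_sub_right, inner_sub_right,
      inner_eq_of_identDistrib (hABY.comp (u := fun v : E × E × E ↦ v.2) (by fun_prop)),
      inner_eq_of_identDistrib (hABY.comp (u := fun v : E × E × E ↦ (v.2.1, v.1)) (by fun_prop))]
  have hlift : lawLift P F Y - lawLift P F X = lawLift P' F Y' - lawLift P' F X' :=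
    congrArg₂ (F · - F ·) (hABY.comp (measurable_snd.comp measurable_snd)).map_eq
      (h.comp measurable_fst).map_eq
  refine ⟨Y, (norm_sub_le_norm_sub_add_norm_sub Y A X).trans (add_le_add hYA.le hAX), ?_⟩
  rw [← hlift, ← hinner, ← hYA]
  refine (abs_sub_inner_sub_le _ X ξ A B Y).trans ?_
  gcongr

theorem IsAtomless.hasGradientAt_lawLift_of_identDistrib (hP : IsAtomless P) {X ξ : Lp E 2 P}
    {X' ξ' : Lp E 2 P'} (h : IdentDistrib (fun ω ↦ (X ω, ξ ω)) (fun ω ↦ (X' ω, ξ' ω)) P P')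
    (hF : HasGradientAt (lawLift P F) ξ X) : HasGradientAt (lawLift P' F) ξ' X' := by
  rw [hasGradientAt_iff_isLittleO, Asymptotics.isLittleO_iff] at hF ⊢
  intro ε hε
  obtain ⟨δ, hδ, hball⟩ := Metric.eventually_nhds_iff.1 (hF hε)
  refine Metric.eventually_nhds_iff.2 ⟨δ, hδ, fun Y' hY' ↦ ?_⟩
  rw [dist_eq_norm] at hY'
  set r := ‖Y' - X'‖
  have hη (η : ℝ) (hη : η ∈ Ioo 0 (δ - r)) :
      ‖lawLift P' F Y' - lawLift P' F X' - inner ℝ ξ' (Y' - X')‖ ≤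
        ε * (r + η) + η * r + ‖ξ‖ * η := by
    obtain ⟨Y, hYX, hY⟩ := hP.exists_abs_lawLift_sub_inner_le F h Y' hη.1
    have hX : |lawLift P F Y - lawLift P F X - inner ℝ ξ (Y - X)| ≤ ε * ‖Y - X‖ :=
      hball (by rw [dist_eq_norm]; linarith [hη.2])
    refine hY.trans ?_
    gcongr
    exact hX.trans (by gcongr)
  have hlim : Tendsto (fun η : ℝ ↦ ε * (r + η) + η * r + ‖ξ‖ * η) (𝓝[>] 0) (𝓝 (ε * r)) := by
    have hcont : Continuous fun η : ℝ ↦ ε * (r + η) + η * r + ‖ξ‖ * η := by fun_prop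
    simpa using (hcont.tendsto 0).mono_left nhdsWithin_le_nhds
  refine ge_of_tendsto hlim ?_
  filter_upwards [Ioo_mem_nhdsGT (sub_pos.2 hY')] with η using hη η

theorem IsAtomless.hasGradientAt_lawLift_toLp (hP : IsAtomless P) {X ξ : Lp E 2 P} {u v : Ω' → E}
    (hu : MemLp u 2 P') (hv : MemLp v 2 P')
    (h : IdentDistrib (fun ω ↦ (X ω, ξ ω)) (fun ω ↦ (u ω, v ω)) P P')
    (hF : HasGradientAt (lawLift P F) ξ X) : HasGradientAt (lawLift P' F) hv.toLp hu.toLp := by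
  refine hP.hasGradientAt_lawLift_of_identDistrib
    (h.trans (.of_ae_eq h.aemeasurable_snd ?_)) hF
  filter_upwards [hu.coeFn_toLp, hv.coeFn_toLp] with ω huω hvω
  rw [huω, hvω]

theorem IsAtomless.exists_gradient_lawLift_ae_eq_comp (hP : IsAtomless P) {X ξ : Lp E 2 P}
    (hF : HasGradientAt (lawLift P F) ξ X) :
    ∃ g : E → E, StronglyMeasurable g ∧ ξ =ᵐ[P] g ∘ X := by
  have hXξ : AEMeasurable (fun ω ↦ (X ω, ξ ω)) P :=
    (Lp.aestronglyMeasurable X).aemeasurable.prodMk (Lp.aestronglyMeasurable ξ).aemeasurable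
  have := Measure.isProbabilityMeasure_map hXξ
  set ρ := P.map fun ω ↦ (X ω, ξ ω)
  have hfst : IdentDistrib (fun ω ↦ (X ω, ξ ω)) (fun p ↦ (p.1, p.2.1)) P (condIndepSquare ρ) :=
    ⟨hXξ, by fun_prop, (map_condIndepSquare_fst ρ).symm⟩
  have hsnd : IdentDistrib (fun ω ↦ (X ω, ξ ω)) (fun p ↦ (p.1, p.2.2)) P (condIndepSquare ρ) :=
    ⟨hXξ, by fun_prop, (map_condIndepSquare_snd ρ).symm⟩
  have hX := (hfst.comp measurable_fst).memLp_snd (Lp.memLp X)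
  have hξ₁ := (hfst.comp measurable_snd).memLp_snd (Lp.memLp ξ)
  have hξ₂ := (hsnd.comp measurable_snd).memLp_snd (Lp.memLp ξ)
  have heq := (hP.hasGradientAt_lawLift_toLp hX hξ₁ hfst hF).unique
    (hP.hasGradientAt_lawLift_toLp hX hξ₂ hsnd hF)
  obtain ⟨g, hg, hgρ⟩ :=
    exists_stronglyMeasurable_ae_snd_eq ((MemLp.toLp_eq_toLp_iff hξ₁ hξ₂).1 heq)
  exact ⟨g, hg, ae_of_ae_map hXξ hgρ⟩

theorem IsAtomless.hasLawGradientAt_of_hasGradientAt (hP : IsAtomless P) {X : Lp E 2 P}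
    (hX : MeasurePreserving X P μ) {g : Lp E 2 μ}
    (hF : HasGradientAt (lawLift P F) (Lp.compMeasurePreserving X hX g) X) :
    HasLawGradientAt P' F μ g := fun _ hX' ↦
  hP.hasGradientAt_lawLift_of_identDistrib
    ((identDistrib_prodMk_compMeasurePreserving hX g).symm.trans
      (identDistrib_prodMk_compMeasurePreserving hX' g)) hF

theorem LawDifferentiableAt.exists_hasLawGradientAt (hF : LawDifferentiableAt P F μ)
    (hP : IsAtomless P) :
    ∃ g : Lp E 2 μ, HasLawGradientAt P F μ g ∧ HasLawGradientAt P' F μ g := by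
  obtain ⟨X, hX, hdiff⟩ := hF
  obtain ⟨g₀, hg₀, hg₀X⟩ := hP.exists_gradient_lawLift_ae_eq_comp hdiff.hasGradientAt
  obtain ⟨g, hg⟩ := exists_compMeasurePreserving_eq hX hg₀.aestronglyMeasurable hg₀X
  have hgrad := hg ▸ hdiff.hasGradientAt
  exact ⟨g, hP.hasLawGradientAt_of_hasGradientAt hX hgrad,
    hP.hasLawGradientAt_of_hasGradientAt hX hgrad⟩

theorem LawDifferentiableAt.of_isAtomless [IsProbabilityMeasure P']
    (hF : LawDifferentiableAt P F μ) (hP : IsAtomless P) (hP' : IsAtomless P') :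
    LawDifferentiableAt P' F μ := by
  obtain ⟨g, -, hg⟩ := hF.exists_hasLawGradientAt (P' := P') hP
  obtain ⟨X, hX, -⟩ := hF
  have : IsProbabilityMeasure μ :=
    hX.map_eq ▸ Measure.isProbabilityMeasure_map hX.measurable.aemeasurable
  have hμ : MemLp id 2 μ := by
    rw [← hX.map_eq]
    exact (memLp_map_measure_iff (by fun_prop) hX.measurable.aemeasurable).2 (Lp.memLp X)
  obtain ⟨X', hX'⟩ := hP'.exists_lp_measurePreserving hμ
  exact ⟨X', hX', (hg X' hX').differentiableAt⟩

end LawLift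

theorem proposition5_general {E : Type*} [NormedAddCommGroup E] [InnerProductSpace ℝ E]
    [CompleteSpace E] [SecondCountableTopology E] [MeasurableSpace E] [BorelSpace E]
    {Ω : Type*} [MeasurableSpace Ω] (P : Measure Ω) [IsProbabilityMeasure P] (hP : IsAtomless P)
    {Ω' : Type*} [MeasurableSpace Ω'] (P' : Measure Ω') [IsProbabilityMeasure P']
    (F : Measure E → ℝ) (μ : Measure E) :
    (IsAtomless P' → (LawDifferentiableAt P F μ ↔ LawDifferentiableAt P' F μ)) ∧
    (LawDifferentiableAt P F μ →
      ∃ g : Lp E 2 μ, HasLawGradientAt P F μ g ∧ HasLawGradientAt P' F μ g) :=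
  ⟨fun hP' ↦ ⟨fun hF ↦ hF.of_isAtomless hP hP', fun hF ↦ hF.of_isAtomless hP' hP⟩,
    fun hF ↦ hF.exists_hasLawGradientAt hP⟩

section Lift

variable {Ω : Type*} [MeasurableSpace Ω] {P : Measure Ω} [IsProbabilityMeasure P] {d : ℕ}
  {f : P2 d → ℝ} {μ : P2 d}

theorem lift_eq_lawLift : lift P f = lawLift P (Function.extend Subtype.val f 0) :=
  funext fun X ↦ (Subtype.val_injective.extend_apply f 0 (law P X)).symm

theorem law_eq_iff {X : L2 P d} : law P X = μ ↔ MeasurePreserving X P μ.1 :=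
  ⟨measurePreserving_of_law_eq, fun hX ↦ Subtype.ext hX.map_eq⟩

theorem lDifferentiableAt_iff_lawDifferentiableAt :
    LDifferentiableAt P f μ ↔ LawDifferentiableAt P (Function.extend Subtype.val f 0) μ.1 := by
  simp only [LDifferentiableAt, LawDifferentiableAt, law_eq_iff, lift_eq_lawLift]

theorem isLDerivativeAt_iff_hasLawGradientAt {g : L2 μ.1 d} :
    IsLDerivativeAt P f μ g ↔ HasLawGradientAt P (Function.extend Subtype.val f 0) μ.1 g := by
  rw [IsLDerivativeAt, lift_eq_lawLift]
  exact forall_congr' fun X ↦ forall_prop_congr (fun _ ↦ Iff.rfl) law_eq_iff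

end Lift

theorem proposition5
    {Ω : Type*} [MeasurableSpace Ω] (P : Measure Ω) [IsProbabilityMeasure P] (hP : IsAtomless P)
    {Ω' : Type*} [MeasurableSpace Ω'] (P' : Measure Ω') [IsProbabilityMeasure P']
    (hP' : IsAtomless P')
    (d : ℕ) (f : P2 d → ℝ) (μ : P2 d) :
    (LDifferentiableAt P f μ ↔ LDifferentiableAt P' f μ) ∧
    (LDifferentiableAt P f μ →
      ∃ g : L2 μ.1 d, IsLDerivativeAt P f μ g ∧ IsLDerivativeAt P' f μ g) := by
  simp only [lDifferentiableAt_iff_lawDifferentiableAt, isLDerivativeAt_iff_hasLawGradientAt]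
  exact (proposition5_general P hP P' _ μ.1).imp_left (· hP')
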